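/- Let $K$ be a field, $n\ge 0$, let $\mathbb T$ be the set of terms (monic monomials) in the variables $x_1<\dots<x_n$, and let $\mathcal O\subset\mathbb T$ be a finite order ideal (a finite set of terms closed under taking divisors). Let $\partial\mathcal O=\{x_i\tau\mid \tau\in\mathcal O,\ 1\le i\le n\}\setminus\mathcal O$ be its border, and let $\mathcal P_{\mathcal O}$ be the Pommaret basis of the monomial ideal $(\mathbb T\setminus\mathcal O)$, that is, the set of the terms $\sigma\notin\mathcal O$ such that $\sigma/\min(\sigma)\in\mathcal O$, where $\min(\sigma)$ is the smallest variable dividing $\sigma$ (if $\mathcal O=\emptyset$, then $\mathcal P_{\mathcal O}=\{1\}$). Let $C=\{C_{\tau\sigma}\mid \tau\in\partial\mathcal O,\ \sigma\in\mathcal O\}$ be a set of parameters and $\tilde C=\{C_{\tau\sigma}\in C\mid \tau\in\partial\mathcal O\setminus\mathcal P_{\mathcal O}\}$. For $\tau\in\partial\mathcal O$ put $b_\tau=\tau-\sum_{\sigma\in\mathcal O}C_{\tau\sigma}\sigma\in K[C][x_1,\dots,x_n]$. The generic $\partial\mathcal O$-marked set is $\mathscr B=\{b_\tau\mid\tau\in\partial\mathcal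 O\}$, and the generic $\mathcal P_{\mathcal O}$-marked set is $\mathscr P=\{b_\alpha\mid\alpha\in\mathcal P_{\mathcal O}\}$, which has coefficients in $K[C\setminus\tilde C]$ (if $\mathcal O=\emptyset$, then $\mathscr P=\{1\}$). The head term of $b_\tau$ is $\tau$. Suppose that every head term $\alpha$ has a set $\mathcal T_\alpha\subseteq\mathbb T$ of multiplicative terms. A reduction step replaces a polynomial $g$, in which a term $\alpha\eta$ with $\eta\in\mathcal T_\alpha$ has coefficient $c\neq0$, by $g-c\,\eta\, b_\alpha$; "$g$ reduces to $h$" means that $h$ is obtained from $g$ by finitely many (possibly zero) steps. A polynomial is $\mathcal O$-reduced if all its terms in $x_1,\dots,x_n$ belong to $\mathcal O$. The $\mathbf x$-coefficients of a polynomial are its coefficients as a polynomial in $x_1,\dots,x_n$. For two head terms $\alpha,\alpha'$ put $S(b_\alpha,b_{\alpha'})=\eta b_\alpha-\eta' b_{\alpha'}$, where $\eta\alpha=\eta'\alpha'=\operatorname{lcm}(\alpha,\alpha')$. * Border reduction: order $\partial\mathcal O=\{\beta_1,\dots,\beta_m\}$ increasingly by degree, with ties broken arbitrarily; reduce by $\mathscr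 B$ with $\mathcal T_{\beta_i}=\{\mu\in\mathbb T\mid \beta_j\nmid\beta_i\mu\text{ for all }j>i\}$. Let $\mathfrak B\subseteq K[C]$ be the ideal defining the border marked scheme of $\mathcal O$: it is generated by the $\mathbf x$-coefficients of the $\mathcal O$-reduced polynomials to which the $S(b_\alpha,b_{\alpha'})$ reduce, for all $\alpha,\alpha'\in\partial\mathcal O$ such that $\alpha=x_j\alpha'$ for some $j$ or $x_i\alpha=x_j\alpha'$ for some $i,j$. * Pommaret reduction: reduce by $\mathscr P$ with $\mathcal T_\alpha$ the set of the terms in the variables $x_i\le\min(\alpha)$ (all terms, if $\alpha=1$). Let $\mathfrak P\subseteq K[C\setminus\tilde C]$ be the ideal defining the Pommaret marked scheme of $\mathcal O$: it is generated by the $\mathbf x$-coefficients of the $\mathcal O$-reduced polynomials to which the $S(b_\alpha,b_{\alpha'})$ reduce, for all $\alpha,\alpha'\in\mathcal P_{\mathcal O}$ such that $x_i\alpha\in\alpha'\mathcal T_{\alpha'}$ for some variable $x_i\notin\mathcal T_\alpha$. Theorem. There are polynomials $q_{\tau\sigma}\in K[C\setminus\tilde C]$, one for each $C_{\tau\sigma}\in\tilde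 C$, such that the following hold. 1. For every $\tau\in\partial\mathcal O\setminus\mathcal P_{\mathcal O}$, the polynomial $\sum_{\sigma\in\mathcal O}q_{\tau\sigma}\sigma$ is the unique $\mathcal O$-reduced polynomial in $K[C\setminus\tilde C][x_1,\dots,x_n]$ to which $\tau$ reduces by the Pommaret reduction. 2. If $\mathfrak B'\subseteq K[C]$ is the ideal generated by the $|\tilde C|$ polynomials $C_{\tau\sigma}-q_{\tau\sigma}$, for $C_{\tau\sigma}\in\tilde C$, then $$\mathfrak B=\mathfrak P\,K[C]+\mathfrak B'.$$ -/

import Mathlib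

open MvPolynomial

noncomputable section

namespace MarkedBases

/-- Terms (monic monomials) in `x_1 < ... < x_n`, written additively through their exponent
vectors: multiplication is `+`, the unit term is `0`, and divisibility is `≤`. -/
abbrev Term (n : ℕ) := Fin n →₀ ℕ

/-- The variable `x_i` as a term. -/
abbrev var {n : ℕ} (i : Fin n) : Term n := Finsupp.single i 1

/-- A finite order ideal: a finite set of terms that is closed under divisors. -/
structure FiniteOrderIdeal (n : ℕ) where
  terms : Finset (Term n)
  mem_of_dvd : ∀ σ τ : Term n, τ ∈ terms → σ ≤ τ → σ ∈ terms

/-- The border `∂O = {x_i τ | τ ∈ O} \ O`. -/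
def border {n : ℕ} (O : FiniteOrderIdeal n) : Set (Term n) :=
  {μ | ∃ i : Fin n, ∃ τ ∈ O.terms, μ = τ + var i} \ ↑O.terms

/-- The Pommaret basis `P_O` of the monomial ideal spanned by the terms outside `O`: the terms
`σ` of that ideal such that `σ / min(σ)` is not in the ideal, where `min(σ)` is the smallest
variable that divides `σ`. -/
def pommaretBasis {n : ℕ} (O : FiniteOrderIdeal n) : Set (Term n) :=
  {σ | σ ∉ O.terms ∧ ∀ i : Fin n, IsLeast (↑σ.support : Set (Fin n)) i → σ - var i ∈ O.terms}

/-- A reduction structure: a finite set of head terms, and for each head term `α` an order ideal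
of multiplicative terms and a finite tail set outside the cone of `α`, such that the cones cover
the monomial ideal generated by the head terms. -/
structure ReductionStructure (n : ℕ) where
  head : Set (Term n)
  head_finite : head.Finite
  tail : head → Finset (Term n)
  mult : head → Set (Term n)
  mult_dvd : ∀ (α : head) (σ τ : Term n), τ ∈ mult α → σ ≤ τ → σ ∈ mult α
  cones_cover : ∀ γ : Term n,
    (∃ α : head, ∃ η ∈ mult α, γ = α.1 + η) ↔ ∃ α : head, α.1 ≤ γ
  tail_notMem_cone : ∀ (α : head), ∀ σ ∈ tail α, ¬ ∃ η ∈ mult α, σ = α.1 + η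

/-- A marked set over `A`: for each head term `α` a polynomial of `A[x_1, ..., x_n]` in which `α`
has coefficient one and all of whose other terms lie in the tail set of `α`. -/
structure MarkedSet {n : ℕ} (J : ReductionStructure n) (A : Type*) [CommRing A] where
  poly : J.head → MvPolynomial (Fin n) A
  coeff_head : ∀ α, coeff α.1 (poly α) = 1
  support_subset : ∀ α, ∀ σ ∈ (poly α).support, σ = α.1 ∨ σ ∈ J.tail α

section Reduction

variable {n : ℕ} {J : ReductionStructure n} {A : Type*} [CommRing A]

/-- One reduction step: a term `α η` of `g` in the cone of the head term `α` is rewritten by means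
of the marked polynomial with head term `α`. -/
def Step (F : MarkedSet J A) (g h : MvPolynomial (Fin n) A) : Prop :=
  ∃ α : J.head, ∃ η ∈ J.mult α, coeff (α.1 + η) g ≠ 0 ∧
    h = g - monomial η (coeff (α.1 + η) g) * F.poly α

/-- Reduction in finitely many steps (possibly none). -/
def Reduces (F : MarkedSet J A) : MvPolynomial (Fin n) A → MvPolynomial (Fin n) A → Prop :=
  Relation.ReflTransGen (Step F)

/-- `h` lies in the `A`-module generated by `O`. -/
def IsOReduced (O : FiniteOrderIdeal n) (h : MvPolynomial (Fin n) A) : Prop :=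
  h.support ⊆ O.terms

/-- The S-polynomial of two marked polynomials; `α ⊔ α'` is the least common multiple. -/
def sPoly (F : MarkedSet J A) (α α' : J.head) : MvPolynomial (Fin n) A :=
  monomial (α.1 ⊔ α'.1 - α.1) 1 * F.poly α - monomial (α.1 ⊔ α'.1 - α'.1) 1 * F.poly α'

/-- `(α, α')` is a non-multiplicative couple: for some variable `x_i` which is not multiplicative
for `α`, the term `x_i α` lies in the cone of `α'`. -/
def NonMultiplicative (α α' : J.head) : Prop :=
  ∃ i : Fin n, var i ∉ J.mult α ∧ ∃ δ ∈ J.mult α', α.1 + var i = α'.1 + δ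

/-- `(α, α')` is a neighbour couple: `α = x_j α'` or `x_i α = x_j α'` for some variables. -/
def Neighbour (α α' : J.head) : Prop :=
  (∃ j : Fin n, α.1 = α'.1 + var j) ∨ ∃ i j : Fin n, α.1 + var i = α'.1 + var j

/-- The ideal of `A` generated by all `x`-coefficients of the `O`-reduced polynomials to which the
S-polynomials of the given couples reduce. -/
def sCoeffIdeal (O : FiniteOrderIdeal n) (F : MarkedSet J A)
    (couple : J.head → J.head → Prop) : Ideal A :=
  Ideal.span {c | ∃ (α α' : J.head) (h : MvPolynomial (Fin n) A) (τ : Term n),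
    couple α α' ∧ Reduces F (sPoly F α α') h ∧ IsOReduced O h ∧ c = coeff τ h}

/-- The polynomial `τ - ∑_{σ ∈ O} c_σ σ`. -/
def markedPoly (O : FiniteOrderIdeal n) (τ : Term n) (c : O.terms → A) :
    MvPolynomial (Fin n) A :=
  monomial τ 1 - ∑ σ : O.terms, monomial σ.1 (c σ)

theorem coeff_markedPoly_head (O : FiniteOrderIdeal n) {τ : Term n} (hτ : τ ∉ O.terms)
    (c : O.terms → A) : coeff τ (markedPoly O τ c) = 1 := by
  classical
  simp only [markedPoly, coeff_sub, coeff_monomial, coeff_sum, if_true]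
  rw [Finset.sum_eq_zero, sub_zero]
  intro σ _
  rw [if_neg]
  rintro rfl
  exact hτ σ.2

theorem support_markedPoly (O : FiniteOrderIdeal n) (τ : Term n) (c : O.terms → A)
    (σ : Term n) (hσ : σ ∈ (markedPoly O τ c).support) : σ = τ ∨ σ ∈ O.terms := by
  classical
  by_contra! hne
  rw [mem_support_iff] at hσ
  apply hσ
  simp only [markedPoly, coeff_sub, coeff_monomial, coeff_sum]
  rw [if_neg (Ne.symm hne.1), Finset.sum_eq_zero, sub_zero]
  intro ρ _
  rw [if_neg]
  rintro rfl
  exact hne.2 ρ.2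

end Reduction

section Structures

variable {n : ℕ}

theorem border_finite (O : FiniteOrderIdeal n) : (border O).Finite := by
  refine Set.Finite.subset (Set.finite_iUnion fun i : Fin n =>
    (O.terms.finite_toSet.image fun τ => τ + var i)) ?_
  rintro μ ⟨⟨i, τ, hτ, rfl⟩, _⟩
  exact Set.mem_iUnion.2 ⟨i, τ, hτ, rfl⟩

theorem exists_isLeast_support {σ : Term n} (h : σ ≠ 0) :
    ∃ i, IsLeast (↑σ.support : Set (Fin n)) i :=
  ⟨_, Finset.isLeast_min' _ (Finsupp.support_nonempty_iff.2 h)⟩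

theorem sub_add_var {σ : Term n} {i : Fin n} (h : i ∈ σ.support) :
    σ - var i + var i = σ := by
  apply tsub_add_cancel_of_le
  rw [Finsupp.single_le_iff]
  exact Nat.one_le_iff_ne_zero.2 (Finsupp.mem_support_iff.1 h)

/-- `P_O` is contained in the border (only an empty `O` is an exception). -/
theorem pommaretBasis_mem_border (O : FiniteOrderIdeal n) {α σ : Term n}
    (hα : α ∈ pommaretBasis O) (hσ : σ ∈ O.terms) : α ∈ border O := by
  refine ⟨?_, hα.1⟩
  have h0 : α ≠ 0 := by
    rintro rfl
    exact hα.1 (O.mem_of_dvd _ _ hσ (zero_le))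
  obtain ⟨i, hi⟩ := exists_isLeast_support h0
  exact ⟨i, _, hα.2 i hi, (sub_add_var hi.1).symm⟩

theorem pommaretBasis_finite (O : FiniteOrderIdeal n) : (pommaretBasis O).Finite := by
  refine ((border_finite O).insert 0).subset fun σ hσ => ?_
  by_cases h0 : σ = 0
  · exact Or.inl h0
  · obtain ⟨i, hi⟩ := exists_isLeast_support h0
    exact Or.inr (pommaretBasis_mem_border O hσ (hσ.2 i hi))

theorem exists_pommaret_divisor (O : FiniteOrderIdeal n) (γ : Term n) (hγ : γ ∉ O.terms) :
    ∃ α ∈ pommaretBasis O, ∃ η : Term n,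
      (∀ i ∈ η.support, ∀ j ∈ α.support, i ≤ j) ∧ γ = α + η := by
  induction hd : γ.degree using Nat.strong_induction_on generalizing γ with
  | _ d ih =>
    by_cases hP : γ ∈ pommaretBasis O
    · exact ⟨γ, hP, 0, by simp, by simp⟩
    · have : ∃ i, IsLeast (↑γ.support : Set (Fin n)) i ∧ γ - var i ∉ O.terms := by
        by_contra! hc
        exact hP ⟨hγ, hc⟩
      obtain ⟨i, hi, hn⟩ := this
      have hs := sub_add_var hi.1
      have hdeg : (γ - var i).degree < d := by
        have := congrArg Finsupp.degree hs
        rw [map_add, Finsupp.degree_single] at this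
        omega
      obtain ⟨α, hα, η, hη, he⟩ := ih _ hdeg _ hn rfl
      have hγe : γ = α + (η + var i) := by rw [← add_assoc, ← he, hs]
      refine ⟨α, hα, η + var i, fun k hk j hj => ?_, hγe⟩
      have hk' := Finsupp.support_add hk
      rcases Finset.mem_union.1 hk' with hk' | hk'
      · exact hη k hk' j hj
      · have hki : k = i := by
          have := Finsupp.support_single_subset hk'
          simpa using this
        subst hki
        apply hi.2
        rw [Finset.mem_coe, Finsupp.mem_support_iff] at *
        rw [hγe, Finsupp.add_apply]
        omega

/-- The Pommaret reduction structure: head terms `P_O`, tails `O`, and the multiplicative terms of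
`α` are those in the variables `x_1, ..., min(α)`. -/
def pommaretStructure (O : FiniteOrderIdeal n) : ReductionStructure n where
  head := pommaretBasis O
  head_finite := pommaretBasis_finite O
  tail _ := O.terms
  mult α := {η | ∀ i ∈ η.support, ∀ j ∈ α.1.support, i ≤ j}
  mult_dvd α σ τ hτ h i hi j hj := hτ i (Finsupp.support_mono h hi) j hj
  cones_cover γ := by
    constructor
    · rintro ⟨α, η, _, rfl⟩
      exact ⟨α, le_self_add⟩
    · rintro ⟨α, hα⟩
      obtain ⟨α', hα', η, hη, he⟩ :=
        exists_pommaret_divisor O γ fun h => α.2.1 (O.mem_of_dvd _ _ h hα)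
      exact ⟨⟨α', hα'⟩, η, hη, he⟩
  tail_notMem_cone α σ hσ := by
    rintro ⟨η, _, rfl⟩
    exact α.2.1 (O.mem_of_dvd _ _ hσ le_self_add)

/-- The border reduction structure for a labelling `β_1, ..., β_m` of the border: head terms `∂O`,
tails `O`, and `μ` is multiplicative for `β_i` when no `β_j` with `j > i` divides `β_i μ`. -/
def borderStructure (O : FiniteOrderIdeal n) {m : ℕ} (β : Fin m ≃ border O) :
    ReductionStructure n where
  head := border O
  head_finite := border_finite O
  tail _ := O.terms
  mult α := {μ | ∀ j : Fin m, β.symm α < j → ¬ (β j).1 ≤ α.1 + μ}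
  mult_dvd α σ τ hτ h j hj hle := hτ j hj (hle.trans (by gcongr))
  cones_cover γ := by
    constructor
    · rintro ⟨α, η, _, rfl⟩
      exact ⟨α, le_self_add⟩
    · rintro ⟨α, hα⟩
      classical
      obtain ⟨k, hk, hmax⟩ := Finset.exists_max_image
        (Finset.univ.filter fun j : Fin m => (β j).1 ≤ γ) id ⟨β.symm α, by simpa using hα⟩
      simp only [Finset.mem_filter, Finset.mem_univ, true_and, id] at hk hmax
      refine ⟨β k, γ - (β k).1, fun j hj hle => ?_, (add_tsub_cancel_of_le hk).symm⟩
      rw [add_tsub_cancel_of_le hk] at hle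
      rw [Equiv.symm_apply_apply] at hj
      exact absurd (hmax j hle) (not_le.2 hj)
  tail_notMem_cone α σ hσ := by
    rintro ⟨η, _, rfl⟩
    exact α.2.2 (O.mem_of_dvd _ _ hσ le_self_add)

/-- The set `C` of parameters `C_{τ σ}`, with `τ ∈ ∂O` and `σ ∈ O`. -/
abbrev Param (O : FiniteOrderIdeal n) := border O × O.terms

/-- The set `C̃` of the parameters `C_{τ σ}` with `τ ∈ ∂O \ P_O`. -/
def tildeParam (O : FiniteOrderIdeal n) : Set (Param O) := {c | c.1.1 ∉ pommaretBasis O}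

variable (K : Type*) [Field K]

/-- The generic `∂O`-marked set `{τ - ∑_σ C_{τ σ} σ | τ ∈ ∂O}` over `K[C]`. -/
def genericBorderSet (O : FiniteOrderIdeal n) {m : ℕ} (β : Fin m ≃ border O) :
    MarkedSet (borderStructure O β) (MvPolynomial (Param O) K) where
  poly τ := markedPoly O τ.1 fun σ => X (τ, σ)
  coeff_head τ := coeff_markedPoly_head O τ.2.2 _
  support_subset τ := support_markedPoly O τ.1 _

/-- The generic `P_O`-marked set `{τ - ∑_σ C_{τ σ} σ | τ ∈ P_O}` over `K[C \ C̃]`. -/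
def genericPommaretSet (O : FiniteOrderIdeal n) :
    MarkedSet (pommaretStructure O) (MvPolynomial ↥(tildeParam O)ᶜ K) where
  poly α := markedPoly O α.1 fun σ =>
    X ⟨(⟨α.1, pommaretBasis_mem_border O α.2 σ.2⟩, σ), fun h => h α.2⟩
  coeff_head α := coeff_markedPoly_head O α.2.1 _
  support_subset α := support_markedPoly O α.1 _

/-- The ideal of `K[C]` that defines the border marked scheme. -/
def borderIdeal (O : FiniteOrderIdeal n) {m : ℕ} (β : Fin m ≃ border O) :
    Ideal (MvPolynomial (Param O) K) :=
  sCoeffIdeal O (genericBorderSet K O β) Neighbour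

/-- The ideal of `K[C \ C̃]` that defines the Pommaret marked scheme. -/
def pommaretIdeal (O : FiniteOrderIdeal n) : Ideal (MvPolynomial ↥(tildeParam O)ᶜ K) :=
  sCoeffIdeal O (genericPommaretSet K O) NonMultiplicative

/-- The inclusion `K[C \ C̃] ⊆ K[C]`. -/
def paramInclusion (O : FiniteOrderIdeal n) :
    MvPolynomial ↥(tildeParam O)ᶜ K →ₐ[K] MvPolynomial (Param O) K :=
  rename Subtype.val

end Structures

end MarkedBases

end

open MarkedBases

/-! Over any coefficient ring, disjoint cones and a level that drops at each rewriting give every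
polynomial a unique normal form: an `O`-reduced polynomial that differs from it by a combination of
multiplicative multiples of the marked polynomials (`eq_zero_of_mem_coneSpan`, `reduces_iff`).
Normal forms are linear and commute with base change.

Each of the two ideals is thereby controlled by ring maps. If `φ` kills the S-coefficients, the
S-polynomials over the target have normal form zero, and a basis criterion shows that the ideal of
the marked set contains no nonzero `O`-reduced polynomial. Conversely, if that ideal contains none,
`φ` kills the S-coefficients. The Pommaret criterion is an induction on the multiplier
(`pommaret_monomial_mul_mem`); the border criterion comes from commuting multiplication operators
(`borderMul_comm`).

Let `q` collect the coefficients of the Pommaret normal forms of the border terms outside `P_O`.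
Modulo `𝔓 K[C] + 𝔅'` every border polynomial lies in the ideal of the Pommaret marked set, so the
S-coefficients of the border vanish. Modulo `𝔅` the Pommaret polynomials are among the border
polynomials, so `𝔓` vanishes; moreover the two rewritings of a border term outside `P_O` differ by
an `O`-reduced element of the border ideal, hence agree, which gives `C = q`. -/

noncomputable section

namespace MarkedBases

/-! ### Normal forms for terminating reduction structures, and base change. -/

section NormalForms

variable {n : ℕ} {J : ReductionStructure n} {A : Type*} [CommRing A]
  {L : Type*} [LinearOrder L]

/-- The cones of `J` partition the complement of `O`, and the multipliers of the cones drop along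
`lvl` when a multiple of an element of `O` is rewritten. -/
structure IsTerminating (J : ReductionStructure n) (O : FiniteOrderIdeal n) (lvl : Term n → L) :
    Prop where
  add_notMem : ∀ (α : J.head) (η : Term n), α.1 + η ∉ O.terms
  cover : ∀ γ ∉ O.terms, ∃ α : J.head, ∃ η ∈ J.mult α, γ = α.1 + η
  disjoint : ∀ (α α' : J.head), ∀ η ∈ J.mult α, ∀ η' ∈ J.mult α', α.1 + η = α'.1 + η' → α = α'
  tail_subset : ∀ α, J.tail α ⊆ O.terms
  lvl_lt : ∀ σ ∈ O.terms, ∀ (η : Term n) (α : J.head), ∀ η' ∈ J.mult α, σ + η = α.1 + η' →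
    lvl η' < lvl η

/-- The `A`-module spanned by the multiplicative multiples `η b_α` with `p η`. -/
def coneSpan (F : MarkedSet J A) (p : Term n → Prop) : Submodule A (MvPolynomial (Fin n) A) :=
  Submodule.span A {f | ∃ α : J.head, ∃ η ∈ J.mult α, p η ∧ f = monomial η 1 * F.poly α}

theorem monomial_mul_mem_coneSpan (F : MarkedSet J A) {p : Term n → Prop} (α : J.head)
    {η : Term n} (hη : η ∈ J.mult α) (hp : p η) (c : A) :
    monomial η c * F.poly α ∈ coneSpan F p := by
  have : monomial η c * F.poly α = c • (monomial η 1 * F.poly α) := by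
    rw [← smul_mul_assoc, smul_monomial, smul_eq_mul, mul_one]
  rw [this]
  exact Submodule.smul_mem _ _ (Submodule.subset_span ⟨α, η, hη, hp, rfl⟩)

theorem exists_of_coeff_monomial_mul {γ η : Term n} {c : A} {f : MvPolynomial (Fin n) A}
    (h : coeff γ (monomial η c * f) ≠ 0) : ∃ ρ ∈ f.support, γ = ρ + η := by
  rw [coeff_monomial_mul'] at h
  split_ifs at h with hle
  · exact ⟨γ - η, mem_support_iff.2 fun h0 => h (by rw [h0, mul_zero]),
      (tsub_add_cancel_of_le hle).symm⟩
  · exact absurd rfl h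

open Classical in
/-- The level of the multiplier of a term in its cone, and `⊥` for a term outside all cones. -/
def coneLevel (J : ReductionStructure n) (lvl : Term n → L) (γ : Term n) : WithBot L :=
  if h : ∃ p : J.head × Term n, p.2 ∈ J.mult p.1 ∧ γ = p.1.1 + p.2 then
    lvl (Classical.choose h).2 else ⊥

theorem coeff_step_self (F : MarkedSet J A) (g : MvPolynomial (Fin n) A) (α : J.head)
    (η : Term n) :
    coeff (α.1 + η) (g - monomial η (coeff (α.1 + η) g) * F.poly α) = 0 := by
  rw [coeff_sub, add_comm α.1 η, coeff_monomial_mul, F.coeff_head, mul_one, sub_self]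

namespace IsTerminating

variable {O : FiniteOrderIdeal n} {lvl : Term n → L} (T : IsTerminating J O lvl)
include T

theorem coneLevel_add {α : J.head} {η : Term n} (hη : η ∈ J.mult α) :
    coneLevel J lvl (α.1 + η) = lvl η := by
  have h : ∃ p : J.head × Term n, p.2 ∈ J.mult p.1 ∧ α.1 + η = p.1.1 + p.2 := ⟨(α, η), hη, rfl⟩
  rw [coneLevel, dif_pos h]
  obtain ⟨h1, h2⟩ := Classical.choose_spec h
  have h3 := T.disjoint _ _ _ hη _ h1 h2
  rw [← h3] at h2
  rw [← add_left_cancel h2]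

theorem coneLevel_of_mem {σ : Term n} (hσ : σ ∈ O.terms) : coneLevel J lvl σ = ⊥ := by
  rw [coneLevel, dif_neg]
  rintro ⟨p, _, rfl⟩
  exact T.add_notMem _ _ hσ

/-- This is the descent behind termination: rewriting a term with multiplier `η` introduces only
terms `σ + η` with `σ ∈ O`, all of lower level. -/
theorem coneLevel_add_lt {σ : Term n} (hσ : σ ∈ O.terms) (η : Term n) :
    coneLevel J lvl (σ + η) < lvl η := by
  by_cases h : σ + η ∈ O.terms
  · rw [T.coneLevel_of_mem h]
    exact WithBot.bot_lt_coe _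
  · obtain ⟨α, η', hη', he⟩ := T.cover _ h
    rw [he, T.coneLevel_add hη', WithBot.coe_lt_coe]
    exact T.lvl_lt σ hσ η α η' hη' he

theorem mem_of_mem_support (F : MarkedSet J A) {α : J.head} {σ : Term n}
    (hσ : σ ∈ (F.poly α).support) : σ = α.1 ∨ σ ∈ O.terms :=
  (F.support_subset α σ hσ).imp_right fun h => T.tail_subset α h

theorem support_step (F : MarkedSet J A) {g : MvPolynomial (Fin n) A} {α : J.head}
    {η γ : Term n} (hγ : γ ∈ (g - monomial η (coeff (α.1 + η) g) * F.poly α).support) :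
    (γ ∈ g.support ∧ γ ≠ α.1 + η) ∨ ∃ σ ∈ O.terms, σ ∈ J.tail α ∧ γ = σ + η := by
  have hne : γ ≠ α.1 + η := by
    rintro rfl
    exact mem_support_iff.1 hγ (coeff_step_self F g α η)
  by_cases hg : γ ∈ g.support
  · exact Or.inl ⟨hg, hne⟩
  · right
    rw [mem_support_iff, coeff_sub, notMem_support_iff.1 hg, zero_sub, neg_ne_zero] at hγ
    obtain ⟨ρ, hρ, rfl⟩ := exists_of_coeff_monomial_mul hγ
    rcases F.support_subset α ρ hρ with rfl | h
    · exact absurd rfl hne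
    · exact ⟨ρ, T.tail_subset α h, h, rfl⟩

theorem exists_reduces [WellFoundedLT L] (F : MarkedSet J A) (g : MvPolynomial (Fin n) A) :
    ∃ h, Reduces F g h ∧ IsOReduced O h := by
  classical
  let r : Term n → Term n → Prop := InvImage (· < ·) (coneLevel J lvl)
  have hwf : WellFounded r := InvImage.wf _ wellFounded_lt
  -- The multiset only has to contain the support, so it does not matter which coefficients cancel:
  -- each step replaces one term by finitely many of lower level.
  suffices H : ∀ (s : Multiset (Term n)) (g : MvPolynomial (Fin n) A),
      (∀ γ ∈ g.support, γ ∈ s) → ∃ h, Reduces F g h ∧ IsOReduced O h from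
    H g.support.val g fun γ hγ => hγ
  intro s
  induction s using hwf.cutExpand.induction with
  | _ s ih =>
    intro g hg
    by_cases hO : IsOReduced O g
    · exact ⟨g, Relation.ReflTransGen.refl, hO⟩
    · obtain ⟨γ, hγ, hγO⟩ := Finset.not_subset.1 hO
      obtain ⟨α, η, hη, rfl⟩ := T.cover γ hγO
      have hstep : Step F g (g - monomial η (coeff (α.1 + η) g) * F.poly α) :=
        ⟨α, η, hη, mem_support_iff.1 hγ, rfl⟩
      let t : Multiset (Term n) := (J.tail α).val.map (· + η)
      obtain ⟨h, hh, hh'⟩ := ih (s.erase (α.1 + η) + t)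
        (by
          refine ⟨t, α.1 + η, ?_, ?_⟩
          · intro γ' hγ'
            obtain ⟨σ, hσ, rfl⟩ := Multiset.mem_map.1 hγ'
            change coneLevel J lvl _ < coneLevel J lvl _
            rw [T.coneLevel_add hη]
            exact T.coneLevel_add_lt (T.tail_subset α hσ) η
          · rw [add_right_comm, Multiset.add_comm (s.erase _), Multiset.singleton_add,
              Multiset.cons_erase (hg _ hγ)])
        _
        (by
          intro γ' hγ'
          rw [Multiset.mem_add]
          rcases T.support_step F hγ' with ⟨h1, h2⟩ | ⟨σ, _, hσ, rfl⟩
          · exact Or.inl ((Multiset.mem_erase_of_ne h2).2 (hg _ h1))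
          · exact Or.inr (Multiset.mem_map_of_mem _ hσ))
      exact ⟨h, Relation.ReflTransGen.head hstep hh, hh'⟩

/-- Levels never rise along a reduction, so a bound on the terms of `g` bounds every multiplier
used. The Pommaret criterion needs this control for its induction. -/
theorem sub_mem_coneSpan_of_reduces (F : MarkedSet J A) {g h : MvPolynomial (Fin n) A}
    (hr : Reduces F g h) {l : L} (hg : ∀ γ ∈ g.support, coneLevel J lvl γ < l) :
    g - h ∈ coneSpan F (fun η => lvl η < l) := by
  suffices H : (∀ γ ∈ h.support, coneLevel J lvl γ < l) ∧
      g - h ∈ coneSpan F (fun η => lvl η < l) from H.2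
  induction hr with
  | refl => exact ⟨hg, by rw [sub_self]; exact Submodule.zero_mem _⟩
  | tail _ hs ih =>
    obtain ⟨ih1, ih2⟩ := ih
    rename_i b _ _
    obtain ⟨α, η, hη, hc, rfl⟩ := hs
    have hl := ih1 _ (mem_support_iff.2 hc)
    rw [T.coneLevel_add hη, WithBot.coe_lt_coe] at hl
    constructor
    · intro γ hγ
      rcases T.support_step F hγ with ⟨h1, _⟩ | ⟨σ, hσ, _, rfl⟩
      · exact ih1 _ h1
      · exact (T.coneLevel_add_lt hσ η).trans (WithBot.coe_lt_coe.2 hl)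
    · rw [← sub_add]
      exact Submodule.add_mem _ ih2 (monomial_mul_mem_coneSpan F α hη hl _)

theorem eq_zero_of_mem_coneSpan (F : MarkedSet J A) {f : MvPolynomial (Fin n) A}
    {p : Term n → Prop} (hf : f ∈ coneSpan F p) (hO : IsOReduced O f) : f = 0 := by
  classical
  let v : {q : J.head × Term n // q.2 ∈ J.mult q.1} → MvPolynomial (Fin n) A :=
    fun q => monomial q.1.2 1 * F.poly q.1.1
  have hf' : f ∈ Submodule.span A (Set.range v) := by
    refine Submodule.span_mono ?_ hf
    rintro _ ⟨α, η, hη, _, rfl⟩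
    exact ⟨⟨(α, η), hη⟩, rfl⟩
  obtain ⟨c, rfl⟩ := (Finsupp.mem_span_range_iff_exists_finsupp).1 hf'
  by_cases hc : c = 0
  · rw [hc, Finsupp.sum_zero_index]
  -- At a multiplier of maximal level the head term cannot cancel: the cones are disjoint, and a
  -- tail term hitting it would come from a multiplier of higher level. So a term outside `O`
  -- survives.
  obtain ⟨q, hq, hmax⟩ := Finset.exists_max_image c.support (fun q => lvl q.1.2)
    (Finsupp.support_nonempty_iff.2 hc)
  have hcoeff : coeff (q.1.1.1 + q.1.2) (c.sum fun i a => a • v i) = c q := by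
    rw [Finsupp.sum, coeff_sum, Finset.sum_eq_single_of_mem q hq]
    · rw [coeff_smul, add_comm, coeff_monomial_mul, F.coeff_head, mul_one, smul_eq_mul, mul_one]
    · intro q' hq' hne
      rw [coeff_smul]
      by_contra h0
      have h1 : coeff (q.1.1.1 + q.1.2) (v q') ≠ 0 := fun h => h0 (by rw [h, smul_zero])
      obtain ⟨ρ, hρ, he⟩ := exists_of_coeff_monomial_mul h1
      rcases T.mem_of_mem_support F hρ with rfl | hρO
      · have h2 := T.disjoint _ _ _ q.2 _ q'.2 he
        rw [h2] at he
        exact hne (Subtype.ext (Prod.ext h2.symm (add_left_cancel he).symm))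
      · exact absurd (hmax q' hq') (not_le.2 (T.lvl_lt ρ hρO _ _ _ q.2 he.symm))
  have hmem : q.1.1.1 + q.1.2 ∈ (c.sum fun i a => a • v i).support := by
    rw [mem_support_iff, hcoeff]
    exact Finsupp.mem_support_iff.1 hq
  exact absurd (hO hmem) (T.add_notMem _ _)

end IsTerminating

theorem sub_mem_coneSpan (F : MarkedSet J A) {g h : MvPolynomial (Fin n) A}
    (hr : Reduces F g h) : g - h ∈ coneSpan F (fun _ => True) := by
  induction hr with
  | refl => rw [sub_self]; exact Submodule.zero_mem _
  | tail _ hs ih =>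
    obtain ⟨α, η, hη, hc, rfl⟩ := hs
    rw [← sub_add]
    exact Submodule.add_mem _ ih (monomial_mul_mem_coneSpan F α hη trivial _)

theorem IsOReduced.sub {O : FiniteOrderIdeal n} {f g : MvPolynomial (Fin n) A}
    (hf : IsOReduced O f) (hg : IsOReduced O g) : IsOReduced O (f - g) := by
  classical
  exact (support_sub (Fin n) f g).trans (Finset.union_subset hf hg)

theorem IsOReduced.map {O : FiniteOrderIdeal n} {B : Type*} [CommRing B] (φ : A →+* B)
    {f : MvPolynomial (Fin n) A} (hf : IsOReduced O f) : IsOReduced O (MvPolynomial.map φ f) :=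
  (support_map_subset φ f).trans hf

theorem isOReduced_sum (O : FiniteOrderIdeal n) (c : O.terms → A) :
    IsOReduced O (∑ σ : O.terms, monomial σ.1 (c σ)) := by
  classical
  intro γ hγ
  by_contra h
  rw [mem_support_iff, coeff_sum] at hγ
  apply hγ
  refine Finset.sum_eq_zero fun σ _ => ?_
  rw [coeff_monomial, if_neg]
  rintro rfl
  exact h σ.2

theorem coeff_sum_terms (O : FiniteOrderIdeal n) (c : O.terms → A) (σ : O.terms) :
    coeff σ.1 (∑ σ : O.terms, monomial σ.1 (c σ)) = c σ := by
  classical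
  rw [coeff_sum, Finset.sum_eq_single σ]
  · rw [coeff_monomial, if_pos rfl]
  · intro ρ _ hne
    rw [coeff_monomial, if_neg fun h => hne (Subtype.ext h)]
  · simp

theorem IsOReduced.eq_sum {O : FiniteOrderIdeal n} {f : MvPolynomial (Fin n) A}
    (hf : IsOReduced O f) : f = ∑ σ : O.terms, monomial σ.1 (coeff σ.1 f) := by
  classical
  ext γ
  by_cases h : γ ∈ O.terms
  · exact (coeff_sum_terms O (fun σ => coeff σ.1 f) ⟨γ, h⟩).symm
  · rw [notMem_support_iff.1 fun h' => h (hf h'),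
      notMem_support_iff.1 fun h' => h (isOReduced_sum O _ h')]

/-- `h` is the normal form of `g`. -/
def IsNormalForm (O : FiniteOrderIdeal n) (F : MarkedSet J A) (g h : MvPolynomial (Fin n) A) :
    Prop :=
  g - h ∈ coneSpan F (fun _ => True) ∧ IsOReduced O h

theorem isNormalForm_of_reduces {O : FiniteOrderIdeal n} {F : MarkedSet J A}
    {g h : MvPolynomial (Fin n) A} (hr : Reduces F g h) (hO : IsOReduced O h) :
    IsNormalForm O F g h :=
  ⟨sub_mem_coneSpan F hr, hO⟩

theorem IsTerminating.isNormalForm_unique {O : FiniteOrderIdeal n} {lvl : Term n → L}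
    (T : IsTerminating J O lvl) {F : MarkedSet J A} {g h h' : MvPolynomial (Fin n) A}
    (H : IsNormalForm O F g h) (H' : IsNormalForm O F g h') : h = h' := by
  have h1 := Submodule.sub_mem _ H'.1 H.1
  rw [sub_sub_sub_cancel_left] at h1
  exact sub_eq_zero.1 (T.eq_zero_of_mem_coneSpan F h1 (H.2.sub H'.2))

/-- A step requires a nonzero coefficient, so reduction itself is neither additive nor stable under
ring maps; membership in the span of the cones is both. -/
theorem IsTerminating.reduces_iff [WellFoundedLT L] {O : FiniteOrderIdeal n} {lvl : Term n → L}
    (T : IsTerminating J O lvl) {F : MarkedSet J A} {g h : MvPolynomial (Fin n) A} :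
    (Reduces F g h ∧ IsOReduced O h) ↔ IsNormalForm O F g h := by
  refine ⟨fun H => isNormalForm_of_reduces H.1 H.2, fun H => ?_⟩
  obtain ⟨h', hr, hO⟩ := T.exists_reduces F g
  rw [T.isNormalForm_unique H (isNormalForm_of_reduces hr hO)]
  exact ⟨hr, hO⟩

/-- Base change of a marked set. -/
def MarkedSet.map {B : Type*} [CommRing B] (φ : A →+* B) (F : MarkedSet J A) : MarkedSet J B where
  poly α := MvPolynomial.map φ (F.poly α)
  coeff_head α := by rw [coeff_map, F.coeff_head, map_one]
  support_subset α σ hσ := F.support_subset α σ (support_map_subset φ _ hσ)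

theorem IsNormalForm.map {O : FiniteOrderIdeal n} {B : Type*} [CommRing B] (φ : A →+* B)
    {F : MarkedSet J A} {g h : MvPolynomial (Fin n) A} (H : IsNormalForm O F g h) :
    IsNormalForm O (F.map φ) (MvPolynomial.map φ g) (MvPolynomial.map φ h) := by
  refine ⟨?_, H.2.map φ⟩
  rw [← map_sub]
  refine Submodule.span_induction (p := fun f _ => MvPolynomial.map φ f ∈ _) ?_ ?_ ?_ ?_ H.1
  · rintro _ ⟨α, η, hη, _, rfl⟩
    rw [map_mul, map_monomial]
    exact monomial_mul_mem_coneSpan (F.map φ) α hη trivial _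
  · rw [map_zero]; exact Submodule.zero_mem _
  · intro f g _ _ hf hg
    rw [map_add]; exact Submodule.add_mem _ hf hg
  · intro a f _ hf
    rw [smul_eq_C_mul, map_mul, map_C, ← smul_eq_C_mul]
    exact Submodule.smul_mem _ _ hf

theorem map_sPoly {B : Type*} [CommRing B] (φ : A →+* B) (F : MarkedSet J A) (α α' : J.head) :
    MvPolynomial.map φ (sPoly F α α') = sPoly (F.map φ) α α' := by
  simp only [sPoly, map_sub, map_mul, map_monomial, map_one, MarkedSet.map]

/-- The ideal generated by a marked set. -/
def MarkedSet.ideal (F : MarkedSet J A) : Ideal (MvPolynomial (Fin n) A) :=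
  Ideal.span (Set.range F.poly)

theorem MarkedSet.poly_mem_ideal (F : MarkedSet J A) (α : J.head) : F.poly α ∈ F.ideal :=
  Ideal.subset_span ⟨α, rfl⟩

theorem mem_ideal_of_mem_coneSpan (F : MarkedSet J A) {p : Term n → Prop}
    {f : MvPolynomial (Fin n) A} (hf : f ∈ coneSpan F p) : f ∈ F.ideal := by
  have : coneSpan F p ≤ F.ideal.restrictScalars A := by
    refine Submodule.span_le.2 ?_
    rintro _ ⟨α, η, _, _, rfl⟩
    exact Ideal.mul_mem_left _ _ (F.poly_mem_ideal α)
  exact this hf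

theorem sPoly_mem_ideal (F : MarkedSet J A) (α α' : J.head) : sPoly F α α' ∈ F.ideal :=
  Ideal.sub_mem _ (Ideal.mul_mem_left _ _ (F.poly_mem_ideal α))
    (Ideal.mul_mem_left _ _ (F.poly_mem_ideal α'))

/-- If all monomial multiples of the marked polynomials lie in the span of the cones, so does the
ideal generated by the marked set. -/
theorem MarkedSet.mem_coneSpan_of_mem_ideal (F : MarkedSet J A)
    (H : ∀ (μ : Term n) (α : J.head), monomial μ 1 * F.poly α ∈ coneSpan F (fun _ => True))
    {f : MvPolynomial (Fin n) A} (hf : f ∈ F.ideal) : f ∈ coneSpan F (fun _ => True) := by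
  suffices h : ∀ g : MvPolynomial (Fin n) A, g * f ∈ coneSpan F (fun _ => True) by
    simpa using h 1
  refine Submodule.span_induction
    (p := fun f _ => ∀ g : MvPolynomial (Fin n) A, g * f ∈ coneSpan F (fun _ => True))
    ?_ ?_ ?_ ?_ hf
  · rintro _ ⟨α, rfl⟩ g
    induction g using MvPolynomial.induction_on' with
    | monomial μ a =>
      have : monomial μ a * F.poly α = a • (monomial μ 1 * F.poly α) := by
        rw [← smul_mul_assoc, smul_monomial, smul_eq_mul, mul_one]
      rw [this]
      exact Submodule.smul_mem _ _ (H μ α)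
    | add p q hp hq =>
      rw [add_mul]
      exact Submodule.add_mem _ hp hq
  · intro g
    rw [mul_zero]
    exact Submodule.zero_mem _
  · intro f f' _ _ hf hf' g
    rw [mul_add]
    exact Submodule.add_mem _ (hf g) (hf' g)
  · intro a f _ hf g
    rw [smul_eq_mul, ← mul_assoc]
    exact hf (g * a)

end NormalForms

/-! ### Termination of the Pommaret reduction, and the Pommaret basis criterion. -/

section Pommaret

variable {n : ℕ} {O : FiniteOrderIdeal n} {A : Type*} [CommRing A]

theorem toColex_lt_iff {f g : Fin n → ℕ} :
    toColex f < toColex g ↔ ∃ k : Fin n, (∀ l, k < l → f l = g l) ∧ f k < g k :=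
  Iff.rfl

instance wellFoundedLT_colex :
    @WellFoundedLT (Colex (Fin n → ℕ)) Pi.Colex.linearOrder.toPartialOrder.toLT :=
  Pi.Colex.wellFoundedLT

/-- At the largest index `k` where the multipliers differ, `η'` involves `x_k`, so `α'` has no
variable below `x_k`. Comparing exponents, `α'` divides `α / min(α)`, which lies in `O`. -/
theorem not_toColex_lt_of_mem_pommaretBasis {α α' η η' : Term n} (hα : α ∈ pommaretBasis O)
    (hα' : α' ∈ pommaretBasis O) (hη' : ∀ i ∈ η'.support, ∀ j ∈ α'.support, i ≤ j)
    (he : α + η = α' + η') : ¬ toColex (⇑η) < toColex (⇑η') := by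
  rw [toColex_lt_iff]
  rintro ⟨k, hk, hlt⟩
  have hcoord : ∀ l, α l + η l = α' l + η' l := fun l => DFunLike.congr_fun he l
  have hk' : k ∈ η'.support := Finsupp.mem_support_iff.2 (by omega)
  have hlow : ∀ l < k, α' l = 0 := fun l hl => by
    by_contra h0
    exact absurd (hη' k hk' l (Finsupp.mem_support_iff.2 h0)) (not_le.2 hl)
  have hαk : α k ≠ 0 := by have := hcoord k; omega
  obtain ⟨i, hi⟩ := exists_isLeast_support (σ := α) (by rintro rfl; exact hαk rfl)
  have hik : i ≤ k := hi.2 (Finsupp.mem_support_iff.2 hαk)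
  refine hα'.1 (O.mem_of_dvd _ _ (hα.2 i hi) fun l => ?_)
  rw [Finsupp.tsub_apply, Finsupp.single_apply]
  rcases lt_trichotomy l k with h | h | h
  · rw [hlow l h]
    exact Nat.zero_le _
  · subst h
    have := hcoord l
    split_ifs <;> omega
  · rw [if_neg (hik.trans_lt h).ne]
    have := hcoord l
    have := hk l h
    omega

/-- Otherwise `α` would divide `σ`: it has no variable below the top index where the multipliers
differ, a smaller exponent there and equal exponents above. -/
theorem toColex_lt_of_mem_terms {σ α η η' : Term n} (hσ : σ ∈ O.terms)
    (hα : α ∈ pommaretBasis O) (hη' : ∀ i ∈ η'.support, ∀ j ∈ α.support, i ≤ j)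
    (he : σ + η = α + η') : toColex (⇑η') < toColex (⇑η) := by
  have hcoord : ∀ l, σ l + η l = α l + η' l := fun l => DFunLike.congr_fun he l
  rcases lt_trichotomy (toColex (⇑η')) (toColex (⇑η)) with h | h | h
  · exact h
  · have h' : η' = η := DFunLike.coe_injective (toColex.injective h)
    rw [h'] at he
    exact absurd (add_right_cancel he ▸ hσ) hα.1
  · obtain ⟨k, hk, hlt⟩ := toColex_lt_iff.1 h
    have hk' : k ∈ η'.support := Finsupp.mem_support_iff.2 (by omega)
    refine absurd (O.mem_of_dvd _ _ hσ fun l => ?_) hα.1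
    rcases lt_trichotomy l k with h | h | h
    · have : α l = 0 := by
        by_contra h0
        exact absurd (hη' k hk' l (Finsupp.mem_support_iff.2 h0)) (not_le.2 h)
      omega
    · subst h
      have := hcoord l
      omega
    · have := hcoord l
      have := hk l h
      omega

theorem pommaretStructure_isTerminating (O : FiniteOrderIdeal n) :
    IsTerminating (pommaretStructure O) O (fun η => toColex (⇑η : Fin n → ℕ)) where
  add_notMem α η h := α.2.1 (O.mem_of_dvd _ _ h le_self_add)
  cover γ hγ := by
    obtain ⟨α, hα, η, hη, he⟩ := exists_pommaret_divisor O γ hγ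
    exact ⟨⟨α, hα⟩, η, hη, he⟩
  disjoint α α' η hη η' hη' he := by
    have h1 := not_toColex_lt_of_mem_pommaretBasis α.2 α'.2 hη' he
    have h2 := not_toColex_lt_of_mem_pommaretBasis α'.2 α.2 hη he.symm
    have h3 : η = η' :=
      DFunLike.coe_injective (toColex.injective (le_antisymm (not_lt.1 h2) (not_lt.1 h1)))
    rw [h3] at he
    exact Subtype.ext (add_right_cancel he)
  tail_subset α := Finset.Subset.refl _
  lvl_lt σ hσ η α η' hη' he := toColex_lt_of_mem_terms hσ α.2 hη' he

theorem sup_eq_add_of_nonMultiplicative {α α' δ : Term n} {i : Fin n}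
    (hα : ¬ α' ≤ α) (he : α + var i = α' + δ) : α ⊔ α' = α + var i := by
  have hcoord : ∀ l, α l + (var i : Term n) l = α' l + δ l := fun l => DFunLike.congr_fun he l
  have hi : α i < α' i := by
    by_contra h
    refine hα fun l => ?_
    by_cases hl : l = i
    · subst hl
      exact not_lt.1 h
    · have := hcoord l
      rw [Finsupp.single_eq_of_ne hl] at this
      omega
  ext l
  rw [Finsupp.sup_apply, Finsupp.add_apply]
  have := hcoord l
  by_cases hl : l = i
  · subst hl
    rw [Finsupp.single_eq_same] at this ⊢
    omega
  · rw [Finsupp.single_eq_of_ne hl] at this ⊢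
    omega

/-- Induction on `μ` in the colexicographic order. If `μ` contains a nonmultiplicative `x_i`, write
`x_i α = α' δ` in its cone; then `δ < x_i`. The S-polynomial reduces to zero with multipliers below
`x_i`, so multiplying by `μ / x_i` expresses `μ b_α` through multiples with multipliers below `μ`.
-/
theorem pommaret_monomial_mul_mem (F : MarkedSet (pommaretStructure O) A)
    (H : ∀ α α' : (pommaretStructure O).head, NonMultiplicative α α' →
      IsNormalForm O F (sPoly F α α') 0) (μ : Term n) (α : (pommaretStructure O).head) :
    monomial μ 1 * F.poly α ∈ coneSpan F (fun _ => True) := by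
  have T := pommaretStructure_isTerminating O
  induction hl : toColex (⇑μ) using WellFoundedLT.induction generalizing μ α with
  | _ l ih =>
    subst hl
    by_cases hμ : μ ∈ (pommaretStructure O).mult α
    · exact monomial_mul_mem_coneSpan F α hμ trivial 1
    have hμ' : ∃ i ∈ μ.support, ∃ j ∈ α.1.support, j < i := by
      by_contra! h
      exact hμ h
    obtain ⟨i, hi, j, hj, hji⟩ := hμ'
    have hvar : var i ∉ (pommaretStructure O).mult α := fun h =>
      absurd (h i (by simp) j hj) (not_le.2 hji)
    obtain ⟨α', δ, hδ, he⟩ := T.cover _ (T.add_notMem α (var i))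
    have hlt : toColex (⇑δ) < toColex (⇑(var i : Term n)) := by
      refine lt_of_le_of_ne
        (not_lt.1 (not_toColex_lt_of_mem_pommaretBasis α.2 α'.2 hδ he)) fun h => ?_
      have h' : δ = var i := DFunLike.coe_injective (toColex.injective h)
      rw [h'] at he hδ
      exact hvar (Subtype.ext (add_right_cancel he) ▸ hδ)
    -- If `α'` divided `α`, then `δ` would be a multiple of `x_i`, against `δ < x_i`.
    have hdvd : ¬ α'.1 ≤ α.1 := fun h => by
      obtain ⟨ε, hε⟩ := le_iff_exists_add.1 h
      have hδε : δ = ε + var i := by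
        rw [hε, add_assoc] at he
        exact (add_left_cancel he).symm
      rw [hδε] at hlt
      exact absurd (Pi.toColex_monotone (a := ⇑(var i : Term n)) (b := ⇑(ε + var i))
        fun k => Nat.le_add_left _ _) (not_le.2 hlt)
    have hsup : α.1 ⊔ α'.1 = α.1 + var i := sup_eq_add_of_nonMultiplicative hdvd he
    have hS : sPoly F α α' = monomial (var i) 1 * F.poly α - monomial δ 1 * F.poly α' := by
      rw [sPoly, hsup, add_tsub_cancel_left, he, add_tsub_cancel_left]
    have hred := (T.reduces_iff.2 (H α α' ⟨i, hvar, δ, hδ, he⟩)).1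
    have hmem := T.sub_mem_coneSpan_of_reduces F hred (l := toColex (⇑(var i : Term n))) (by
      intro γ hγ
      -- The head terms cancel in the S-polynomial; what remains are tail terms times `x_i` or `δ`,
      -- all of level below `x_i`.
      have hne : γ ≠ α.1 + var i := by
        rintro rfl
        rw [mem_support_iff, hS, coeff_sub] at hγ
        apply hγ
        conv_lhs => rw [add_comm, coeff_monomial_mul, F.coeff_head, add_comm, he, add_comm,
          coeff_monomial_mul, F.coeff_head, sub_self]
      rw [mem_support_iff, hS, coeff_sub] at hγ
      by_cases h1 : coeff γ (monomial (var i) 1 * F.poly α) = 0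
      · rw [h1, zero_sub, neg_ne_zero] at hγ
        obtain ⟨ρ, hρ, rfl⟩ := exists_of_coeff_monomial_mul hγ
        rcases T.mem_of_mem_support F hρ with rfl | hρ
        · exact absurd he.symm hne
        · exact (T.coneLevel_add_lt hρ δ).trans (WithBot.coe_lt_coe.2 hlt)
      · obtain ⟨ρ, hρ, rfl⟩ := exists_of_coeff_monomial_mul h1
        rcases T.mem_of_mem_support F hρ with rfl | hρ
        · exact absurd rfl hne
        · exact T.coneLevel_add_lt hρ (var i))
    rw [sub_zero, hS] at hmem
    have hmul : ∀ η : Term n, toColex (⇑η) < toColex (⇑(var i : Term n)) →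
        ∀ α'', monomial (μ - var i + η) 1 * F.poly α'' ∈ coneSpan F (fun _ => True) := by
      intro η hη α''
      refine ih _ ?_ _ _ rfl
      conv_rhs => rw [← sub_add_var hi]
      obtain ⟨k, hk, hlt'⟩ := toColex_lt_iff.1 hη
      exact toColex_lt_iff.2 ⟨k, fun l hl => congrArg ((μ - var i) l + ·) (hk l hl),
        Nat.add_lt_add_left hlt' _⟩
    have hmul' : ∀ f ∈ coneSpan F (fun η => toColex (⇑η) < toColex (⇑(var i : Term n))),
        monomial (μ - var i) 1 * f ∈ coneSpan F (fun _ => True) := by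
      intro f hf
      refine Submodule.span_induction
        (p := fun f _ => monomial (μ - var i) 1 * f ∈ coneSpan F (fun _ => True)) ?_ ?_ ?_ ?_ hf
      · rintro _ ⟨α'', η, _, hη, rfl⟩
        rw [← mul_assoc, monomial_mul, one_mul]
        exact hmul η hη α''
      · rw [mul_zero]
        exact Submodule.zero_mem _
      · intro f g _ _ hf hg
        rw [mul_add]
        exact Submodule.add_mem _ hf hg
      · intro a f _ hf
        rw [mul_smul_comm]
        exact Submodule.smul_mem _ _ hf
    have h1 := Submodule.add_mem _ (hmul' _ hmem) (hmul δ hlt α')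
    have h2 : monomial μ (1 : A) = monomial (μ - var i) 1 * monomial (var i) 1 := by
      rw [monomial_mul, one_mul, sub_add_var hi]
    have h3 : monomial (μ - var i + δ) (1 : A) = monomial (μ - var i) 1 * monomial δ 1 := by
      rw [monomial_mul, one_mul]
    rw [h3] at h1
    rw [h2]
    convert h1 using 1
    ring

/-- The Pommaret marked basis criterion. -/
theorem pommaret_eq_zero_of_mem_ideal (F : MarkedSet (pommaretStructure O) A)
    (H : ∀ α α' : (pommaretStructure O).head, NonMultiplicative α α' →
      IsNormalForm O F (sPoly F α α') 0) {f : MvPolynomial (Fin n) A} (hf : f ∈ F.ideal)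
    (hO : IsOReduced O f) : f = 0 :=
  (pommaretStructure_isTerminating O).eq_zero_of_mem_coneSpan F
    (F.mem_coneSpan_of_mem_ideal (pommaret_monomial_mul_mem F H) hf) hO

end Pommaret

/-! ### The normal form as a linear map. -/

section NormalFormMap

variable {n : ℕ} {J : ReductionStructure n} {A : Type*} [CommRing A]
  {L : Type*} [LinearOrder L] {O : FiniteOrderIdeal n}

theorem IsOReduced.add {f g : MvPolynomial (Fin n) A}
    (hf : IsOReduced O f) (hg : IsOReduced O g) : IsOReduced O (f + g) := by
  classical
  exact support_add.trans (Finset.union_subset hf hg)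

theorem IsOReduced.smul {f : MvPolynomial (Fin n) A} (hf : IsOReduced O f) (a : A) :
    IsOReduced O (a • f) :=
  support_smul.trans hf

theorem isOReduced_monomial {σ : Term n} (hσ : σ ∈ O.terms) (a : A) :
    IsOReduced O (monomial σ a) :=
  support_monomial_subset.trans (Finset.singleton_subset_iff.2 hσ)

theorem isNormalForm_self {F : MarkedSet J A} {f : MvPolynomial (Fin n) A}
    (hf : IsOReduced O f) : IsNormalForm O F f f :=
  ⟨by rw [sub_self]; exact Submodule.zero_mem _, hf⟩

/-- Passing to the normal form, as a linear map. -/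
def IsTerminating.normalForm [WellFoundedLT L] {lvl : Term n → L} (T : IsTerminating J O lvl)
    (F : MarkedSet J A) : MvPolynomial (Fin n) A →ₗ[A] MvPolynomial (Fin n) A where
  toFun g := Classical.choose (T.exists_reduces F g)
  map_add' f g := by
    have hf := T.reduces_iff.1 (Classical.choose_spec (T.exists_reduces F f))
    have hg := T.reduces_iff.1 (Classical.choose_spec (T.exists_reduces F g))
    refine T.isNormalForm_unique
      (T.reduces_iff.1 (Classical.choose_spec (T.exists_reduces F (f + g)))) ⟨?_, hf.2.add hg.2⟩
    rw [add_sub_add_comm]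
    exact Submodule.add_mem _ hf.1 hg.1
  map_smul' a f := by
    have hf := T.reduces_iff.1 (Classical.choose_spec (T.exists_reduces F f))
    refine T.isNormalForm_unique
      (T.reduces_iff.1 (Classical.choose_spec (T.exists_reduces F (a • f)))) ⟨?_, hf.2.smul a⟩
    rw [RingHom.id_apply, ← smul_sub]
    exact Submodule.smul_mem _ _ hf.1

theorem IsTerminating.isNormalForm_normalForm [WellFoundedLT L] {lvl : Term n → L}
    (T : IsTerminating J O lvl) (F : MarkedSet J A) (g : MvPolynomial (Fin n) A) :
    IsNormalForm O F g (T.normalForm F g) :=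
  T.reduces_iff.1 (Classical.choose_spec (T.exists_reduces F g))

theorem IsTerminating.normalForm_eq [WellFoundedLT L] {lvl : Term n → L}
    (T : IsTerminating J O lvl) {F : MarkedSet J A} {g h : MvPolynomial (Fin n) A}
    (H : IsNormalForm O F g h) : T.normalForm F g = h :=
  T.isNormalForm_unique (T.isNormalForm_normalForm F g) H

end NormalFormMap

/-! ### Termination of the border reduction, and the border basis criterion. -/

section Border

variable {n : ℕ} {O : FiniteOrderIdeal n} {A : Type*} [CommRing A]
  {m : ℕ} {β : Fin m ≃ border O}

/-- A path from `σ` to `σ + η` that adds one variable at a time must leave `O`, and the term where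
it leaves is in the border. -/
theorem exists_mem_border_le {σ η : Term n} (hσ : σ ∈ O.terms) (hη : σ + η ∉ O.terms) :
    ∃ τ ∈ border O, σ.degree < τ.degree ∧ τ ≤ σ + η := by
  induction hd : η.degree using Nat.strong_induction_on generalizing η with
  | _ d ih =>
    have h0 : η ≠ 0 := by
      rintro rfl
      exact hη (by rwa [add_zero])
    obtain ⟨i, hi⟩ := Finsupp.support_nonempty_iff.2 h0
    have hs := sub_add_var hi
    have hdeg : (η - var i).degree + 1 = η.degree := by
      conv_rhs => rw [← hs, map_add, Finsupp.degree_single]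
    by_cases h : σ + (η - var i) ∈ O.terms
    · refine ⟨σ + η, ⟨⟨i, _, h, by rw [add_assoc, hs]⟩, hη⟩, ?_, le_rfl⟩
      rw [map_add]
      omega
    · obtain ⟨τ, hτ, hd', hle⟩ := ih _ (by omega) h rfl
      exact ⟨τ, hτ, hd', hle.trans (by gcongr; exact tsub_le_self)⟩

theorem borderStructure_isTerminating (hO : O.terms.Nonempty)
    (hβ : Monotone fun i => Finsupp.degree (β i).1) :
    IsTerminating (borderStructure O β) O (Finsupp.degree : Term n → ℕ) where
  add_notMem α η h := α.2.2 (O.mem_of_dvd _ _ h le_self_add)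
  cover γ hγ := by
    obtain ⟨σ, hσ⟩ := hO
    have h0 : (0 : Term n) ∈ O.terms := O.mem_of_dvd _ _ hσ zero_le
    obtain ⟨τ, hτ, _, hle⟩ := exists_mem_border_le (η := γ) h0 (by rwa [zero_add])
    rw [zero_add] at hle
    exact ((borderStructure O β).cones_cover γ).2 ⟨⟨τ, hτ⟩, hle⟩
  disjoint α α' η hη η' hη' he := by
    apply β.symm.injective
    rcases lt_trichotomy (β.symm α) (β.symm α') with h | h | h
    · refine absurd ?_ (hη _ h)
      have h' := congrArg Subtype.val (β.apply_symm_apply α')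
      exact (h'.trans_le le_self_add).trans_eq he.symm
    · exact h
    · refine absurd ?_ (hη' _ h)
      have h' := congrArg Subtype.val (β.apply_symm_apply α)
      exact (h'.trans_le le_self_add).trans_eq he
  tail_subset α := Finset.Subset.refl _
  lvl_lt σ hσ η α η' hη' he := by
    -- The head term of a cone has the largest label among the border terms dividing `σ + η`. One of
    -- these has degree above that of `σ`, and labels respect degree, so `α` has larger degree than
    -- `σ` and the multiplier loses degree.
    have hn : σ + η ∉ O.terms := fun h => α.2.2 (O.mem_of_dvd _ _ (he ▸ h) le_self_add)
    obtain ⟨τ, hτ, hd, hle⟩ := exists_mem_border_le hσ hn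
    have h1 : β.symm ⟨τ, hτ⟩ ≤ β.symm α := by
      by_contra h
      refine hη' _ (not_le.1 h) ?_
      rw [Equiv.apply_symm_apply, ← he]
      exact hle
    have h2 : τ.degree ≤ α.1.degree := by
      have h := hβ h1
      have h' := congrArg Subtype.val (β.apply_symm_apply α)
      simp only [Equiv.apply_symm_apply] at h
      exact h.trans_eq (congrArg _ h')
    have h3 := congrArg Finsupp.degree he
    rw [map_add, map_add] at h3
    omega

/-- A border term with a later label has at least the same degree, so it can divide `τ` only by
being equal to it. Hence each `b_τ` rewrites its own head term. -/
theorem zero_mem_mult_border (hβ : Monotone fun i => Finsupp.degree (β i).1)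
    (τ : (borderStructure O β).head) : 0 ∈ (borderStructure O β).mult τ := by
  intro j hj hle
  rw [add_zero] at hle
  have h1 : τ.1.degree ≤ (β j).1.degree :=
    (congrArg _ (congrArg Subtype.val (β.apply_symm_apply τ))).symm.trans_le (hβ hj.le)
  obtain ⟨ε, hε⟩ := le_iff_exists_add.1 hle
  have h2 := congrArg Finsupp.degree hε
  rw [map_add] at h2
  have h3 : ε = 0 := (Finsupp.degree_eq_zero_iff ε).1 (by omega)
  rw [h3, add_zero] at hε
  have h4 : τ = β j := Subtype.ext hε
  rw [h4, Equiv.symm_apply_apply] at hj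
  exact lt_irrefl _ hj

/-- The polynomial `∑_σ c_σ σ` when the marked polynomial is `τ - ∑_σ c_σ σ`. -/
def MarkedSet.tailPoly {J : ReductionStructure n} (F : MarkedSet J A) (τ : J.head) :
    MvPolynomial (Fin n) A :=
  monomial τ.1 1 - F.poly τ

theorem MarkedSet.isOReduced_tailPoly {J : ReductionStructure n} (hJ : ∀ τ, J.tail τ ⊆ O.terms)
    (F : MarkedSet J A) (τ : J.head) :
    IsOReduced O (F.tailPoly τ) := by
  classical
  intro γ hγ
  rw [mem_support_iff, MarkedSet.tailPoly, coeff_sub, coeff_monomial] at hγ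
  split_ifs at hγ with h
  · subst h
    exact absurd (by rw [F.coeff_head, sub_self]) hγ
  · rw [zero_sub, neg_ne_zero] at hγ
    rcases F.support_subset τ γ (mem_support_iff.2 hγ) with rfl | h'
    · exact absurd rfl h
    · exact hJ τ h'

theorem border_isNormalForm_monomial (hβ : Monotone fun i => Finsupp.degree (β i).1)
    (F : MarkedSet (borderStructure O β) A) (τ : (borderStructure O β).head) :
    IsNormalForm O F (monomial τ.1 1) (F.tailPoly τ) := by
  refine ⟨?_, F.isOReduced_tailPoly (fun _ => Finset.Subset.refl _) τ⟩
  have h := monomial_mul_mem_coneSpan F (p := fun _ => True) τ (zero_mem_mult_border hβ τ)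
    trivial 1
  rw [MarkedSet.tailPoly, sub_sub_cancel]
  simpa using h

variable (hO : O.terms.Nonempty) (hβ : Monotone fun i => Finsupp.degree (β i).1)
  (F : MarkedSet (borderStructure O β) A)

/-- Normal forms with respect to a border marked set. -/
def borderNormalForm : MvPolynomial (Fin n) A →ₗ[A] MvPolynomial (Fin n) A :=
  (borderStructure_isTerminating hO hβ).normalForm F

theorem borderNormalForm_eq_self {f : MvPolynomial (Fin n) A} (hf : IsOReduced O f) :
    borderNormalForm hO hβ F f = f :=
  IsTerminating.normalForm_eq _ (isNormalForm_self hf)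

theorem isOReduced_borderNormalForm (f : MvPolynomial (Fin n) A) :
    IsOReduced O (borderNormalForm hO hβ F f) :=
  (IsTerminating.isNormalForm_normalForm _ F f).2

theorem borderNormalForm_monomial (τ : (borderStructure O β).head) :
    borderNormalForm hO hβ F (monomial τ.1 1) = F.tailPoly τ :=
  IsTerminating.normalForm_eq _ (border_isNormalForm_monomial hβ F τ)

/-- Neighbours of the form `τ = x_i τ'` enter here: with `τ' = x_j σ` in the border, the
S-polynomial is `x_i` times the tail of `τ'` minus the tail of `τ`. -/
theorem borderNormalForm_var_mul_of_mem
    (H : ∀ α α' : (borderStructure O β).head, Neighbour α α' →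
      IsNormalForm O F (sPoly F α α') 0) {σ : Term n} (hσ : σ ∈ O.terms) {i j : Fin n}
    (hi : σ + var i ∈ O.terms) :
    borderNormalForm hO hβ F (X i * borderNormalForm hO hβ F (X j * monomial σ 1)) =
      borderNormalForm hO hβ F (X i * (X j * monomial σ 1)) := by
  have hX : ∀ (k : Fin n) (ρ : Term n), X k * monomial ρ (1 : A) = monomial (ρ + var k) 1 :=
    fun k ρ => by rw [X, monomial_mul, one_mul, add_comm]
  rw [hX j σ]
  by_cases hj : σ + var j ∈ O.terms
  · rw [borderNormalForm_eq_self hO hβ F (isOReduced_monomial hj 1)]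
  · have hn : σ + var j + var i ∉ O.terms := fun h => hj (O.mem_of_dvd _ _ h le_self_add)
    let τ' : (borderStructure O β).head := ⟨σ + var j, ⟨j, σ, hσ, rfl⟩, hj⟩
    let τ : (borderStructure O β).head :=
      ⟨σ + var j + var i, ⟨j, σ + var i, hi, add_right_comm _ _ _⟩, hn⟩
    have hsup : τ.1 ⊔ τ'.1 = τ.1 := sup_eq_left.2 le_self_add
    have hS : sPoly F τ τ' = X i * F.tailPoly τ' - F.tailPoly τ := by
      have h1 : τ.1 - τ'.1 = var i := add_tsub_cancel_left _ _
      have h2 := hX i τ'.1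
      rw [sPoly, hsup, h1, tsub_self, MarkedSet.tailPoly, MarkedSet.tailPoly, mul_sub, h2]
      change 1 * F.poly τ - X i * F.poly τ' = monomial τ.1 1 - X i * F.poly τ' - _
      ring
    have h0 := (borderStructure_isTerminating hO hβ).normalForm_eq
      (H τ τ' (Or.inl ⟨i, rfl⟩))
    change borderNormalForm hO hβ F _ = 0 at h0
    rw [hS, map_sub, borderNormalForm_eq_self hO hβ F
      (F.isOReduced_tailPoly (fun _ => Finset.Subset.refl _) τ), sub_eq_zero] at h0
    rw [hX, borderNormalForm_monomial hO hβ F τ', h0]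
    exact (borderNormalForm_monomial hO hβ F τ).symm

/-- If one of the products stays in `O`, both sides are the normal form of `x_i x_j σ`. Otherwise
`x_i σ` and `x_j σ` are neighbours in the border, and their S-polynomial is the difference of the
two sides before the last normal form. -/
theorem borderNormalForm_var_mul_comm
    (H : ∀ α α' : (borderStructure O β).head, Neighbour α α' →
      IsNormalForm O F (sPoly F α α') 0) {σ : Term n} (hσ : σ ∈ O.terms) (i j : Fin n) :
    borderNormalForm hO hβ F (X i * borderNormalForm hO hβ F (X j * monomial σ 1)) =
      borderNormalForm hO hβ F (X j * borderNormalForm hO hβ F (X i * monomial σ 1)) := by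
  by_cases hi : σ + var i ∈ O.terms
  · rw [borderNormalForm_var_mul_of_mem hO hβ F H hσ hi, mul_left_comm]
    congr 2
    rw [borderNormalForm_eq_self]
    rw [X, monomial_mul, one_mul, add_comm]
    exact isOReduced_monomial hi 1
  by_cases hj : σ + var j ∈ O.terms
  · rw [borderNormalForm_var_mul_of_mem hO hβ F H hσ hj, mul_left_comm]
    congr 2
    rw [borderNormalForm_eq_self]
    rw [X, monomial_mul, one_mul, add_comm]
    exact isOReduced_monomial hj 1
  by_cases hij : i = j
  · rw [hij]
  have hX : ∀ (k : Fin n) (ρ : Term n), X k * monomial ρ (1 : A) = monomial (ρ + var k) 1 :=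
    fun k ρ => by rw [X, monomial_mul, one_mul, add_comm]
  let τ : (borderStructure O β).head := ⟨σ + var i, ⟨i, σ, hσ, rfl⟩, hi⟩
  let τ' : (borderStructure O β).head := ⟨σ + var j, ⟨j, σ, hσ, rfl⟩, hj⟩
  have hsup : τ.1 ⊔ τ'.1 = σ + var i + var j := by
    ext l
    simp only [τ, τ', Finsupp.sup_apply, Finsupp.add_apply, Finsupp.single_apply]
    split_ifs with h1 h2 h2
    · exact absurd (h1.trans h2.symm) hij
    all_goals omega
  have hS : sPoly F τ τ' = X i * F.tailPoly τ' - X j * F.tailPoly τ := by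
    have h1 : σ + var i + var j - τ.1 = var j := add_tsub_cancel_left _ _
    have h2 : σ + var i + var j - τ'.1 = var i := by
      rw [add_right_comm]
      exact add_tsub_cancel_left _ _
    have h3 := hX i τ'.1
    have h4 : X j * monomial τ.1 (1 : A) = monomial (τ'.1 + var i) 1 :=
      (hX j τ.1).trans (by rw [add_right_comm])
    rw [sPoly, hsup, h1, h2, MarkedSet.tailPoly, MarkedSet.tailPoly, mul_sub, mul_sub, h3, h4]
    change X j * F.poly τ - X i * F.poly τ' = _
    ring
  have h0 := (borderStructure_isTerminating hO hβ).normalForm_eq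
    (H τ τ' (Or.inr ⟨j, i, add_right_comm _ _ _⟩))
  change borderNormalForm hO hβ F _ = 0 at h0
  rw [hS, map_sub, sub_eq_zero] at h0
  rw [hX, hX, borderNormalForm_monomial hO hβ F τ, borderNormalForm_monomial hO hβ F τ', h0]

/-- Multiplication by a variable, modulo a border marked set. -/
def borderMul (i : Fin n) : Module.End A (MvPolynomial (Fin n) A) :=
  borderNormalForm hO hβ F ∘ₗ LinearMap.mulLeft A (X i) ∘ₗ borderNormalForm hO hβ F

theorem borderMul_apply (i : Fin n) {f : MvPolynomial (Fin n) A} (hf : IsOReduced O f) :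
    borderMul hO hβ F i f = borderNormalForm hO hβ F (X i * f) := by
  simp only [borderMul, LinearMap.comp_apply, LinearMap.mulLeft_apply,
    borderNormalForm_eq_self hO hβ F hf]

theorem linearMap_eq_of_isOReduced {M : Type*} [AddCommGroup M] [Module A M]
    {p q : MvPolynomial (Fin n) A →ₗ[A] M}
    (h : ∀ σ ∈ O.terms, p (monomial σ 1) = q (monomial σ 1)) {f : MvPolynomial (Fin n) A}
    (hf : IsOReduced O f) : p f = q f := by
  rw [hf.eq_sum, map_sum, map_sum]
  refine Finset.sum_congr rfl fun σ _ => ?_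
  rw [← mul_one (coeff σ.1 f), ← smul_eq_mul, ← smul_monomial, map_smul, map_smul, h σ.1 σ.2]

theorem borderMul_comm
    (H : ∀ α α' : (borderStructure O β).head, Neighbour α α' →
      IsNormalForm O F (sPoly F α α') 0) (i j : Fin n) :
    borderMul hO hβ F i * borderMul hO hβ F j = borderMul hO hβ F j * borderMul hO hβ F i := by
  have key : ∀ f : MvPolynomial (Fin n) A, IsOReduced O f →
      (borderMul hO hβ F i * borderMul hO hβ F j) f =
        (borderMul hO hβ F j * borderMul hO hβ F i) f := by
    intro f hf
    refine linearMap_eq_of_isOReduced (fun σ hσ => ?_) hf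
    have hσ' := isOReduced_monomial (A := A) hσ 1
    rw [Module.End.mul_apply, Module.End.mul_apply, borderMul_apply hO hβ F j hσ',
      borderMul_apply hO hβ F i hσ', borderMul_apply hO hβ F i (isOReduced_borderNormalForm ..),
      borderMul_apply hO hβ F j (isOReduced_borderNormalForm ..)]
    exact borderNormalForm_var_mul_comm hO hβ F H hσ i j
  refine LinearMap.ext fun f => ?_
  -- `borderMul` starts by passing to the normal form, so commutation on `O`-reduced polynomials
  -- suffices.
  have hnf : ∀ k, borderMul hO hβ F k f = borderMul hO hβ F k (borderNormalForm hO hβ F f) :=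
    fun k => by
      simp only [borderMul, LinearMap.comp_apply,
        borderNormalForm_eq_self hO hβ F (isOReduced_borderNormalForm hO hβ F f)]
  have := key _ (isOReduced_borderNormalForm hO hβ F f)
  rwa [Module.End.mul_apply, Module.End.mul_apply, ← hnf, ← hnf] at this

open scoped IsMulCommutative in
/-- The border basis criterion. -/
theorem border_eq_zero_of_mem_ideal (hO : O.terms.Nonempty)
    (hβ : Monotone fun i => Finsupp.degree (β i).1) (F : MarkedSet (borderStructure O β) A)
    (H : ∀ α α' : (borderStructure O β).head, Neighbour α α' →
      IsNormalForm O F (sPoly F α α') 0) {f : MvPolynomial (Fin n) A} (hf : f ∈ F.ideal)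
    (hfO : IsOReduced O f) : f = 0 := by
  have hcomm := Algebra.isMulCommutative_adjoin A (s := Set.range (borderMul hO hβ F)) (by
    rintro _ ⟨i, rfl⟩ _ ⟨j, rfl⟩
    exact borderMul_comm hO hβ F H i j)
  let ψ : MvPolynomial (Fin n) A →ₐ[A] Algebra.adjoin A (Set.range (borderMul hO hβ F)) :=
    aeval fun i => ⟨borderMul hO hβ F i, Algebra.subset_adjoin ⟨i, rfl⟩⟩
  -- Commuting operators make polynomials act, and `P g` is the action of `g` on `1`. The kernel of
  -- `P` is an ideal; `P` kills each `b_τ` and fixes `O`-reduced polynomials, so such a polynomial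
  -- in the ideal is zero.
  let P : MvPolynomial (Fin n) A →ₗ[A] MvPolynomial (Fin n) A :=
    LinearMap.applyₗ (1 : MvPolynomial (Fin n) A) ∘ₗ (Subalgebra.val _).toLinearMap ∘ₗ
      ψ.toLinearMap
  have hPmul : ∀ g g', P (g * g') = (ψ g).1 (P g') := fun g g' => by
    change (ψ (g * g')).1 1 = (ψ g).1 ((ψ g').1 1)
    rw [map_mul]
    rfl
  have hPX : ∀ i g, P (X i * g) = borderMul hO hβ F i (P g) := fun i g => by
    rw [hPmul]
    congr 1
    change (aeval _ (X i) : Algebra.adjoin A (Set.range (borderMul hO hβ F))).1 = _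
    rw [aeval_X]
  have hX : ∀ (k : Fin n) (ρ : Term n), monomial (ρ + var k) (1 : A) = X k * monomial ρ 1 :=
    fun k ρ => by rw [X, monomial_mul, one_mul, add_comm]
  -- Since `O` is closed under divisors, `σ` is built from `1` variable by variable inside `O`,
  -- where no reduction takes place.
  have hP1 : ∀ σ ∈ O.terms, P (monomial σ 1) = monomial σ 1 := by
    intro σ hσ
    induction hd : σ.degree using Nat.strong_induction_on generalizing σ with
    | _ d ih =>
      by_cases h0 : σ = 0
      · subst h0
        exact congrArg (fun e => e.1 1) (map_one ψ)
      · obtain ⟨i, hi⟩ := Finsupp.support_nonempty_iff.2 h0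
        have hs := sub_add_var hi
        have hdeg : (σ - var i).degree + 1 = σ.degree := by
          conv_rhs => rw [← hs, map_add, Finsupp.degree_single]
        have hO' : σ - var i ∈ O.terms := O.mem_of_dvd _ _ hσ tsub_le_self
        rw [← hs, hX, hPX, ih _ (by omega) _ hO' rfl,
          borderMul_apply hO hβ F i (isOReduced_monomial hO' 1), ← hX, hs,
          borderNormalForm_eq_self hO hβ F (isOReduced_monomial hσ 1)]
  have hPO : ∀ g, IsOReduced O g → P g = g := fun g hg =>
    linearMap_eq_of_isOReduced (q := LinearMap.id) hP1 hg
  have hPb : ∀ τ, P (F.poly τ) = 0 := by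
    intro τ
    have h1 : P (monomial τ.1 1) = F.tailPoly τ := by
      obtain ⟨⟨i, σ, hσ, he⟩, _⟩ := τ.2
      rw [he, hX, hPX, hP1 σ hσ, borderMul_apply hO hβ F i (isOReduced_monomial hσ 1), ← hX, ← he,
        borderNormalForm_monomial]
    have h2 : F.poly τ = monomial τ.1 1 - F.tailPoly τ := (sub_sub_cancel _ _).symm
    rw [h2, map_sub, h1, hPO _ (F.isOReduced_tailPoly (fun _ => Finset.Subset.refl _) τ),
      sub_self]
  rw [← hPO f hfO]
  refine Submodule.span_induction (p := fun f _ => P f = 0) ?_ ?_ ?_ ?_ hf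
  · rintro _ ⟨τ, rfl⟩
    exact hPb τ
  · exact map_zero _
  · intro f g _ _ hf hg
    rw [map_add, hf, hg, add_zero]
  · intro a f _ hf
    rw [smul_eq_mul, hPmul, hf, map_zero]

end Border

/-! ### Ring maps that kill the S-coefficients. -/

section BaseChange

variable {n : ℕ} {J : ReductionStructure n} {A B : Type*} [CommRing A] [CommRing B]
  {L : Type*} [LinearOrder L] {O : FiniteOrderIdeal n}

theorem IsTerminating.isNormalForm_map_sPoly_zero [WellFoundedLT L] {lvl : Term n → L}
    (T : IsTerminating J O lvl) {F : MarkedSet J A} {couple : J.head → J.head → Prop}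
    {φ : A →+* B} (hφ : sCoeffIdeal O F couple ≤ RingHom.ker φ) {α α' : J.head}
    (hc : couple α α') : IsNormalForm O (F.map φ) (sPoly (F.map φ) α α') 0 := by
  obtain ⟨h, hr, hO⟩ := T.exists_reduces F (sPoly F α α')
  have h1 := (isNormalForm_of_reduces hr hO).map φ
  have h2 : MvPolynomial.map φ h = 0 := by
    ext τ
    rw [coeff_map, coeff_zero]
    exact hφ (Ideal.subset_span ⟨α, α', h, τ, hc, hr, hO, rfl⟩)
  rwa [h2, map_sPoly] at h1

/-- The normal form of an S-polynomial maps to an `O`-reduced element of the ideal of the mapped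
marked set. -/
theorem sCoeffIdeal_le_ker {F : MarkedSet J A} {couple : J.head → J.head → Prop} {φ : A →+* B}
    (H : ∀ f ∈ (F.map φ).ideal, IsOReduced O f → f = 0) :
    sCoeffIdeal O F couple ≤ RingHom.ker φ := by
  refine Ideal.span_le.2 ?_
  rintro _ ⟨α, α', h, τ, hc, hr, hO, rfl⟩
  have h1 := (isNormalForm_of_reduces hr hO).map φ
  have h2 : MvPolynomial.map φ h ∈ (F.map φ).ideal := by
    have h3 := Ideal.sub_mem _ (sPoly_mem_ideal (F.map φ) α α')
      (mem_ideal_of_mem_coneSpan _ (map_sPoly φ F α α' ▸ h1.1))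
    rwa [sub_sub_cancel] at h3
  change φ (coeff τ h) = 0
  rw [← coeff_map, H _ h2 h1.2, coeff_zero]

theorem sCoeffIdeal_eq_bot (hO : O.terms = ∅) (F : MarkedSet J A)
    (couple : J.head → J.head → Prop) : sCoeffIdeal O F couple = ⊥ := by
  refine Ideal.span_eq_bot.2 ?_
  rintro _ ⟨α, α', h, τ, _, _, hr, rfl⟩
  refine notMem_support_iff.1 fun h' => ?_
  have := hr h'
  rw [hO] at this
  exact absurd this (Finset.notMem_empty _)

theorem map_markedPoly (φ : A →+* B) (τ : Term n) (c : O.terms → A) :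
    MvPolynomial.map φ (markedPoly O τ c) = markedPoly O τ (fun σ => φ (c σ)) := by
  simp only [markedPoly, map_sub, map_sum, map_monomial, map_one]

end BaseChange

/-! ### Comparison of the border and Pommaret ideals. -/

section Comparison

variable {n : ℕ} {O : FiniteOrderIdeal n} {K : Type*} [Field K]

/-- The normal forms of terms with respect to the generic Pommaret marked set. -/
def pommaretNormalForm (K : Type*) [Field K] (O : FiniteOrderIdeal n) (τ : Term n) :
    MvPolynomial (Fin n) (MvPolynomial ↥(tildeParam O)ᶜ K) :=
  (pommaretStructure_isTerminating O).normalForm (genericPommaretSet K O) (monomial τ 1)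

theorem isNormalForm_pommaretNormalForm (τ : Term n) :
    IsNormalForm O (genericPommaretSet K O) (monomial τ 1) (pommaretNormalForm K O τ) :=
  (pommaretStructure_isTerminating O).isNormalForm_normalForm _ _

theorem reduces_iff_eq_pommaretNormalForm (τ : Term n)
    (h : MvPolynomial (Fin n) (MvPolynomial ↥(tildeParam O)ᶜ K)) :
    (Reduces (genericPommaretSet K O) (monomial τ 1) h ∧ IsOReduced O h) ↔
      h = pommaretNormalForm K O τ := by
  rw [(pommaretStructure_isTerminating O).reduces_iff]
  constructor
  · exact fun H => (pommaretStructure_isTerminating O).isNormalForm_unique H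
      (isNormalForm_pommaretNormalForm τ)
  · rintro rfl
    exact isNormalForm_pommaretNormalForm τ

/-- The polynomials that express the parameters in `C̃` through the other ones. -/
def eliminant (K : Type*) [Field K] (O : FiniteOrderIdeal n) (c : tildeParam O) :
    MvPolynomial ↥(tildeParam O)ᶜ K :=
  coeff c.1.2.1 (pommaretNormalForm K O c.1.1.1)

variable {m : ℕ} {β : Fin m ≃ border O} {A : Type*} [CommRing A]

theorem genericPommaretSet_map_poly (hO : O.terms.Nonempty)
    (φ : MvPolynomial (Param O) K →+* A) (α : (pommaretStructure O).head) :
    ((genericPommaretSet K O).map (φ.comp (paramInclusion K O).toRingHom)).poly α =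
      ((genericBorderSet K O β).map φ).poly
        ⟨α.1, pommaretBasis_mem_border O α.2 hO.choose_spec⟩ := by
  change MvPolynomial.map _ (markedPoly O _ _) = MvPolynomial.map _ (markedPoly O _ _)
  rw [map_markedPoly, map_markedPoly]
  congr 1
  funext σ
  change φ (rename Subtype.val (X _)) = φ (X _)
  rw [rename_X]
  rfl

theorem pommaret_ideal_le_border_ideal (hO : O.terms.Nonempty)
    (φ : MvPolynomial (Param O) K →+* A) :
    ((genericPommaretSet K O).map (φ.comp (paramInclusion K O).toRingHom)).ideal ≤
      ((genericBorderSet K O β).map φ).ideal := by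
  refine Ideal.span_le.2 ?_
  rintro _ ⟨α, rfl⟩
  rw [genericPommaretSet_map_poly (β := β) hO]
  exact MarkedSet.poly_mem_ideal _ _

theorem genericBorderSet_map_poly (φ : MvPolynomial (Param O) K →+* A) (τ : border O) :
    ((genericBorderSet K O β).map φ).poly τ =
      monomial τ.1 1 - ∑ σ : O.terms, monomial σ.1 (φ (X (τ, σ))) :=
  map_markedPoly φ τ.1 _

theorem monomial_sub_map_mem_ideal (φ : MvPolynomial (Param O) K →+* A) (τ : Term n) :
    monomial τ 1 - MvPolynomial.map (φ.comp (paramInclusion K O).toRingHom)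
        (pommaretNormalForm K O τ) ∈
      ((genericPommaretSet K O).map (φ.comp (paramInclusion K O).toRingHom)).ideal := by
  have h := mem_ideal_of_mem_coneSpan _
    ((isNormalForm_pommaretNormalForm (K := K) (O := O) τ).map
      (φ.comp (paramInclusion K O).toRingHom)).1
  rwa [map_monomial, map_one] at h

theorem map_pommaretNormalForm (φ : MvPolynomial (Param O) K →+* A) (τ : border O)
    (hτ : τ.1 ∉ pommaretBasis O) :
    MvPolynomial.map (φ.comp (paramInclusion K O).toRingHom) (pommaretNormalForm K O τ.1) =
      ∑ σ : O.terms, monomial σ.1 (φ (paramInclusion K O (eliminant K O ⟨(τ, σ), hτ⟩))) := by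
  conv_lhs => rw [(isNormalForm_pommaretNormalForm (K := K) (O := O) τ.1).2.eq_sum]
  simp only [map_sum, map_monomial]
  rfl

theorem borderIdeal_le (hO : O.terms.Nonempty) :
    borderIdeal K O β ≤ (pommaretIdeal K O).map (paramInclusion K O) ⊔
      Ideal.span (Set.range fun c : tildeParam O =>
        X c.1 - paramInclusion K O (eliminant K O c)) := by
  set I := (pommaretIdeal K O).map (paramInclusion K O) ⊔
      Ideal.span (Set.range fun c : tildeParam O =>
        X c.1 - paramInclusion K O (eliminant K O c)) with hI
  let φ := Ideal.Quotient.mk I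
  have hP : pommaretIdeal K O ≤ RingHom.ker (φ.comp (paramInclusion K O).toRingHom) :=
    fun x hx => Ideal.Quotient.eq_zero_iff_mem.2
      ((le_sup_left : _ ≤ I) (Ideal.mem_map_of_mem (paramInclusion K O) hx))
  have hX : ∀ c : tildeParam O, φ (paramInclusion K O (eliminant K O c)) = φ (X c.1) :=
    fun c => (Ideal.Quotient.mk_eq_mk_iff_sub_mem _ _).2 (by
      rw [← neg_sub]
      exact I.neg_mem ((le_sup_right : _ ≤ I) (Ideal.subset_span ⟨c, rfl⟩)))
  -- For `τ ∈ P_O` the two marked polynomials coincide. For the other `τ`, the relations in `𝔅'`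
  -- turn `b_τ` into `τ` minus its Pommaret normal form.
  have hle : ((genericBorderSet K O β).map φ).ideal ≤
      ((genericPommaretSet K O).map (φ.comp (paramInclusion K O).toRingHom)).ideal := by
    refine Ideal.span_le.2 ?_
    rintro _ ⟨τ, rfl⟩
    by_cases hτ : τ.1 ∈ pommaretBasis O
    · have h := genericPommaretSet_map_poly (β := β) hO φ ⟨τ.1, hτ⟩
      change ((genericBorderSet K O β).map φ).poly τ ∈ _
      exact h ▸ MarkedSet.poly_mem_ideal _ _
    · have h := monomial_sub_map_mem_ideal φ τ.1
      rw [map_pommaretNormalForm φ τ hτ] at h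
      simp only [hX] at h
      exact (genericBorderSet_map_poly φ τ).symm ▸ h
  have hker : RingHom.ker φ = I := Ideal.mk_ker
  rw [← hker]
  exact sCoeffIdeal_le_ker fun f hf hfO => pommaret_eq_zero_of_mem_ideal _
    (fun α α' hc => (pommaretStructure_isTerminating O).isNormalForm_map_sPoly_zero hP hc)
    (hle hf) hfO

theorem le_borderIdeal (hO : O.terms.Nonempty)
    (hβ : Monotone fun i => Finsupp.degree (β i).1) :
    (pommaretIdeal K O).map (paramInclusion K O) ⊔
      Ideal.span (Set.range fun c : tildeParam O =>
        X c.1 - paramInclusion K O (eliminant K O c)) ≤ borderIdeal K O β := by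
  let φ := Ideal.Quotient.mk (borderIdeal K O β)
  have hker : RingHom.ker φ = borderIdeal K O β := Ideal.mk_ker
  have hzero : ∀ f ∈ ((genericBorderSet K O β).map φ).ideal, IsOReduced O f → f = 0 :=
    fun f hf hfO => border_eq_zero_of_mem_ideal hO hβ _ (fun α α' hc =>
      (borderStructure_isTerminating hO hβ).isNormalForm_map_sPoly_zero hker.ge hc) hf hfO
  have hle := pommaret_ideal_le_border_ideal (β := β) hO φ
  refine sup_le ?_ ?_
  · have h : pommaretIdeal K O ≤ RingHom.ker (φ.comp (paramInclusion K O).toRingHom) :=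
      sCoeffIdeal_le_ker fun f hf hfO => hzero f (hle hf) hfO
    exact Ideal.map_le_iff_le_comap.2 fun x hx =>
      Ideal.mem_comap.2 (Ideal.Quotient.eq_zero_iff_mem.1 (h hx))
  · refine Ideal.span_le.2 ?_
    rintro _ ⟨⟨⟨τ, σ⟩, hτ⟩, rfl⟩
    have h1 := hle (monomial_sub_map_mem_ideal φ τ.1)
    have h2 := MarkedSet.poly_mem_ideal ((genericBorderSet K O β).map φ) τ
    rw [genericBorderSet_map_poly] at h2
    rw [map_pommaretNormalForm φ τ hτ] at h1
    -- Both polynomials have head term `τ`, which cancels: the difference is an `O`-reduced element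
    -- of the border ideal, so its coefficients `C - q` vanish.
    have h3 := Ideal.sub_mem _ h1 h2
    rw [sub_sub_sub_cancel_left] at h3
    have h4 := hzero _ h3 ((isOReduced_sum O _).sub (isOReduced_sum O _))
    have h5 := congrArg (coeff σ.1) (sub_eq_zero.1 h4)
    rw [coeff_sum_terms, coeff_sum_terms] at h5
    exact (Ideal.Quotient.mk_eq_mk_iff_sub_mem _ _).1 h5

end Comparison

end MarkedBases

end

theorem theorem4p1 {K : Type*} [Field K] {n : ℕ} (O : FiniteOrderIdeal n)
    {m : ℕ} (β : Fin m ≃ border O) (hβ : Monotone fun i => Finsupp.degree (β i).1) :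
    ∃ (q : tildeParam O → MvPolynomial ↥(tildeParam O)ᶜ K)
      (B' : Ideal (MvPolynomial (Param O) K)),
      (∀ (τ : border O) (hτ : τ.1 ∉ pommaretBasis O)
          (h : MvPolynomial (Fin n) (MvPolynomial ↥(tildeParam O)ᶜ K)),
        (Reduces (genericPommaretSet K O) (monomial τ.1 1) h ∧ IsOReduced O h) ↔
          h = ∑ σ : O.terms, monomial σ.1 (q ⟨(τ, σ), hτ⟩)) ∧
      B' = Ideal.span (Set.range fun c : tildeParam O => X c.1 - paramInclusion K O (q c)) ∧
      borderIdeal K O β = (pommaretIdeal K O).map (paramInclusion K O) ⊔ B' := by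
  refine ⟨eliminant K O, _, fun τ hτ h => ?_, rfl, ?_⟩
  · rw [reduces_iff_eq_pommaretNormalForm,
      (isNormalForm_pommaretNormalForm (K := K) (O := O) τ.1).2.eq_sum]
    rfl
  · rcases O.terms.eq_empty_or_nonempty with hO | hO
    -- An empty `O` has an empty border, so no cone contains `1` and the border structure does not
    -- terminate. But there are no parameters, and all the ideals are zero.
    · have hE : IsEmpty (tildeParam O) :=
        ⟨fun c => Finset.eq_empty_iff_forall_notMem.1 hO _ c.1.2.2⟩
      rw [borderIdeal, pommaretIdeal, sCoeffIdeal_eq_bot hO, sCoeffIdeal_eq_bot hO,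
        Set.range_eq_empty, Ideal.span_empty, Ideal.map_bot, sup_bot_eq]
    · exact le_antisymm (borderIdeal_le hO) (le_borderIdeal hO hβ)
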